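/- \textbf{Definitions.} Let $F$ be a finite field. An $[n,k,d]$ linear code over $F$ is a $k$-dimensional subspace $\mathcal{C}\subseteq F^n$ with minimum Hamming distance $d$. It has \emph{all-symbol $(r,\delta)$-locality} if for every coordinate $j$ there is a set $S_j$ of coordinates with $j\in S_j$ and $|S_j|\le r+\delta-1$ such that the punctured code $\mathcal{C}|_{S_j}$ (keep only the coordinates in $S_j$) has minimum Hamming distance at least $\delta$. An $[n,k,d]$ code with all-symbol $(r,\delta)$-locality is an \emph{optimal LRC} if $$d=n-k+1-\left(\left\lceil\frac{k}{r}\right\rceil-1\right)(\delta-1).$$ An optimal LRC over $F$ has \emph{optimal field size} if every optimal LRC with the same parameters $n,k,d,r,\delta$ over a finite field $K$ satisfies $|K|\ge |F|$. A code is \emph{cyclic} if it is closed under the cyclic shift $(c_0,c_1,\dots,c_{n-1})\mapsto(c_{n-1},c_0,\dots,c_{n-2})$. \textbf{Statement.} Let $q$ be a prime power. 1. (Codes with the parameters of Chen et al.) Let $b\ge 1$, $r=\delta=2$, $n=3m=q^b+1$ and $k=2u$, where $u>0$ is even and $m=u+1$. Then cyclic optimal $[q^b+1,2u,d]$ LRCs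 over $\mathbb{F}_{q^b}$ with all-symbol $(2,2)$-locality exist, and every such code has optimal field size. 2. (Codes with the parameters of Tamo and Barg.) Let $b\ge 2$, $r=2$, $q=r+\delta-1$ and $u=q^{b-1}-1$, and assume that $q^b-1$ is not a prime power. Then optimal $[q^b,\,2u,\,(q^{b-1}-u)q+\delta]$ LRCs over $\mathbb{F}_{q^b}$ with all-symbol $(2,\delta)$-locality exist, and every such code has optimal field size. 3. (Codes with the parameters of the cyclic codes of Tamo et al.) Let $b\ge 1$, $\delta\ge 1$, $r=2$, $n=m(\delta+1)=q^b-1$ and $k=2u$, where $u>0$ and $m=u+1$, and assume that neither $q^b-1$ nor $q^b-2$ is a prime power. Then cyclic optimal $[q^b-1,2u,d]$ LRCs over $\mathbb{F}_{q^b}$ with all-symbol $(2,\delta)$-locality exist, and every such code has optimal field size. -/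

import Mathlib

/-- The code `C` punctured to the coordinates in `S`: the symbols outside `S` are deleted. -/
def puncturedCode {F : Type*} [Field F] {n : ℕ} (C : Submodule F (Fin n → F))
    (S : Finset (Fin n)) : Submodule F (S → F) :=
  C.map (LinearMap.funLeft F F (Subtype.val : S → Fin n))

open Classical in
/-- The minimum Hamming distance of a linear code: the least Hamming distance of two distinct
codewords (`⊤` for a code with a single codeword). -/
noncomputable def minDist {F : Type*} [Field F] {ι : Type*} [Fintype ι]
    (C : Submodule F (ι → F)) : ℕ∞ :=
  ⨅ (x ∈ C) (y ∈ C) (_ : x ≠ y), (hammingDist x y : ℕ∞)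

/-- `S` is an `(r, δ)`-repair set of the `j`th code symbol: `j ∈ S`, `|S| ≤ r + δ - 1`, and the
punctured code on `S` has minimum distance at least `δ`. -/
def IsRepairSet {F : Type*} [Field F] {n : ℕ} (C : Submodule F (Fin n → F)) (r δ : ℕ)
    (j : Fin n) (S : Finset (Fin n)) : Prop :=
  j ∈ S ∧ S.card + 1 ≤ r + δ ∧ (δ : ℕ∞) ≤ minDist (puncturedCode C S)

/-- All-symbol `(r, δ)`-locality: every code symbol has an `(r, δ)`-repair set. -/
def HasAllSymbolLocality {F : Type*} [Field F] {n : ℕ} (C : Submodule F (Fin n → F))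
    (r δ : ℕ) : Prop :=
  ∀ j : Fin n, ∃ S : Finset (Fin n), IsRepairSet C r δ j S

/-- `C` is an optimal `[n, k, d]` locally repairable code with all-symbol `(r, δ)`-locality: its
dimension is `k`, its minimum distance is `d`, every symbol has `(r, δ)`-locality, and the
Singleton-type bound `d ≤ n - k + 1 - (⌈k / r⌉ - 1) (δ - 1)` holds with equality. -/
structure IsOptimalLRC {F : Type*} [Field F] {n : ℕ} (C : Submodule F (Fin n → F))
    (k d r δ : ℕ) : Prop where
  dim_eq : Module.finrank F C = k
  minDist_eq : minDist C = (d : ℕ∞)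
  locality : HasAllSymbolLocality C r δ
  optimal : (d : ℤ) = (n : ℤ) - k + 1 - (⌈(k : ℚ) / (r : ℚ)⌉ - 1) * ((δ : ℤ) - 1)

/-- `C` is an optimal `[n, k, d]` LRC with all-symbol `(r, δ)`-locality whose field size is the
smallest one possible: an optimal LRC with the same parameters `n, k, d, r, δ` over any finite
field `K` satisfies `|F| ≤ |K|`. -/
def HasOptimalFieldSize {F : Type*} [Field F] [Fintype F] {n : ℕ} (C : Submodule F (Fin n → F))
    (k d r δ : ℕ) : Prop :=
  IsOptimalLRC C k d r δ ∧
    ∀ (K : Type) [Field K] [Fintype K] (C' : Submodule K (Fin n → K)),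
      IsOptimalLRC C' k d r δ → Fintype.card F ≤ Fintype.card K

/-- `C` is cyclic: with `(c₀, c₁, …, cₙ₋₁)` it contains `(cₙ₋₁, c₀, …, cₙ₋₂)`. -/
def IsCyclicCode {F : Type*} [Field F] {n : ℕ} (C : Submodule F (Fin n → F)) : Prop :=
  ∀ c ∈ C, (fun i => c ((finRotate n).symm i)) ∈ C

/-! In all three families `r = 2`, `k = 2u` and `n = (u + 1)(δ + 1)`, so optimality forces `d = 2δ +
1`. Everything reduces to one bound, `IsOptimalLRC.length_le_card_add_one`: `n ≤ |K| + 1` over any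
field `K` of such a code. Since `|K|` is a prime power, the primality hypotheses then exclude every
smaller field.

For the bound, a greedy dimension count shows that the repair sets partition the coordinates into `u
+ 1` groups of size `δ + 1`, each determined by two of its symbols. Fix a group `p`. For every
coordinate `j`, some nonzero word vanishes at `j` and lives on `p` and one further group. Its values
at two places of `p` give a point of the projective line over `K`. If two coordinates gave the same
point, a combination of their words would vanish on `p` and have weight at most `2δ`, so it would be
zero, which the supports rule out. Hence `n ≤ |K| + 1`.

For existence, attach to the groups vectors of a plane `E` with sum zero and read each symbol
through a linear form, the forms being pairwise independent (`isOptimalLRC_groupCode`). Evaluation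
of linear polynomials gives lengths up to `|F|`. Powers of a primitive element make the code cyclic
for `n = |F| - 1`, and roots of unity in the quadratic extension do so for odd `n = |F| + 1`. -/

open Module

/-- The subcode of the codewords that vanish on `T`. -/
def vanishingSubcode {K ι : Type*} [Field K] (C : Submodule K (ι → K)) (T : Finset ι) :
    Submodule K (ι → K) where
  carrier := {c | c ∈ C ∧ ∀ i ∈ T, c i = 0}
  add_mem' := fun ha hb => ⟨C.add_mem ha.1 hb.1, fun i hi => by simp [ha.2 i hi, hb.2 i hi]⟩
  zero_mem' := ⟨C.zero_mem, fun _ _ => rfl⟩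
  smul_mem' := fun k _ ha => ⟨C.smul_mem k ha.1, fun i hi => by simp [ha.2 i hi]⟩

/-! ### Dimension counts for vanishing subcodes and the partition into repair sets -/

section Bound

variable {K ι : Type*} [Field K] {C : Submodule K (ι → K)}

theorem mem_vanishingSubcode {T : Finset ι} {c : ι → K} :
    c ∈ vanishingSubcode C T ↔ c ∈ C ∧ ∀ i ∈ T, c i = 0 := Iff.rfl

theorem vanishingSubcode_empty : vanishingSubcode C ∅ = C := by
  ext c; simp [mem_vanishingSubcode]

theorem exists_ne_zero_of_one_le_finrank {T : Finset ι}
    (h : 1 ≤ finrank K (vanishingSubcode C T)) :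
    ∃ c ∈ C, (∀ i ∈ T, c i = 0) ∧ ∃ i, c i ≠ 0 := by
  have : vanishingSubcode C T ≠ ⊥ := by
    intro h0
    rw [h0] at h
    simp at h
  obtain ⟨c, hc, h0⟩ := Submodule.exists_mem_ne_zero_of_ne_bot this
  exact ⟨c, hc.1, hc.2, Function.ne_iff.1 h0⟩

/-- `S` has at most `δ + 1` elements and every codeword with fewer than `δ` nonzero symbols on `S`
vanishes on `S`. -/
def IsLocalSet (C : Submodule K (ι → K)) (δ : ℕ) (S : Finset ι) : Prop :=
  S.card ≤ δ + 1 ∧ ∀ c ∈ C, ∀ Z ⊆ S, S.card < Z.card + δ → (∀ i ∈ Z, c i = 0) → ∀ i ∈ S, c i = 0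

variable [Fintype ι] [DecidableEq ι]

theorem finrank_vanishingSubcode_le (T A : Finset ι) :
    finrank K (vanishingSubcode C T) ≤ finrank K (vanishingSubcode C (T ∪ A)) + A.card := by
  let L : vanishingSubcode C T →ₗ[K] (A → K) :=
    (LinearMap.funLeft K K (Subtype.val : A → ι)).comp (vanishingSubcode C T).subtype
  have h1 := LinearMap.finrank_range_add_finrank_ker L
  have h2 : finrank K (LinearMap.range L) ≤ A.card := by
    simpa using Submodule.finrank_le (LinearMap.range L)
  have h3 : finrank K (LinearMap.ker L) ≤ finrank K (vanishingSubcode C (T ∪ A)) := by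
    rw [LinearEquiv.finrank_eq (Submodule.equivMapOfInjective _
      (vanishingSubcode C T).subtype_injective (LinearMap.ker L))]
    apply Submodule.finrank_mono
    rintro c ⟨⟨c', hc'⟩, hk, rfl⟩
    refine ⟨hc'.1, fun i hi => ?_⟩
    rcases Finset.mem_union.1 hi with h | h
    · exact hc'.2 i h
    · exact congrFun (LinearMap.mem_ker.1 hk) ⟨i, h⟩
  omega

/-- Greedy enlargement of the zero set: `t` times a repair set is absorbed at the price of two
dimensions, `s` times a single symbol at the price of one. One dimension survives, so the final set
still has at most `N` elements. -/
theorem card_add_le_of_finrank_vanishingSubcode {δ N : ℕ} (hδ : 1 ≤ δ)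
    (hN : ∀ T, 1 ≤ finrank K (vanishingSubcode C T) → T.card ≤ N)
    (hloc : ∀ j, ∃ S, j ∈ S ∧ IsLocalSet C δ S) (t : ℕ) :
    ∀ (s : ℕ) (T : Finset ι), 1 + s + 2 * t ≤ finrank K (vanishingSubcode C T) →
      T.card + s + t * (δ + 1) ≤ N := by
  induction t with
  | zero =>
    intro s
    induction s with
    | zero => intro T h; simpa using hN T h
    | succ s ih =>
      intro T h
      obtain ⟨c, hc, h0, i, hi⟩ := exists_ne_zero_of_one_le_finrank (C := C) (T := T) (by omega)
      have hiT : i ∉ T := fun h => hi (h0 i h)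
      have h1 := finrank_vanishingSubcode_le (C := C) T {i}
      have h2 := ih (T ∪ {i}) (by rw [Finset.card_singleton] at h1; omega)
      rw [Finset.card_union_of_disjoint (by simpa using hiT), Finset.card_singleton] at h2
      omega
  | succ t ih =>
    intro s T h
    obtain ⟨c, hc, h0, j, hj⟩ := exists_ne_zero_of_one_le_finrank (C := C) (T := T) (by omega)
    obtain ⟨S, hjS, hS, hloc⟩ := hloc j
    have hcard : δ ≤ (S \ T).card := by
      by_contra hlt
      refine hj (hloc c hc (S ∩ T) Finset.inter_subset_left ?_ (fun i hi => h0 i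
        (Finset.mem_inter.1 hi).2) j hjS)
      have := Finset.card_sdiff_add_card_inter S T
      omega
    -- The least number of new zeros that, with `S ∩ T`, leaves only `δ - 1` symbols of `S` free and
    -- so kills all of `S`. It is 1 or 2.
    obtain ⟨B, hB, hBc⟩ := Finset.exists_subset_card_eq (s := S \ T) (n := (S \ T).card + 1 - δ)
      (by omega)
    have hST : (S \ T).card ≤ δ + 1 := (Finset.card_le_card Finset.sdiff_subset).trans hS
    have h1 := finrank_vanishingSubcode_le (C := C) T B
    have h2 : vanishingSubcode C (T ∪ B) ≤ vanishingSubcode C (T ∪ S) := by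
      intro c' hc'
      refine ⟨hc'.1, fun i hi => ?_⟩
      rcases Finset.mem_union.1 hi with h | h
      · exact hc'.2 i (Finset.mem_union_left _ h)
      · refine hloc c' hc'.1 ((S ∩ T) ∪ B) (Finset.union_subset Finset.inter_subset_left
          (hB.trans Finset.sdiff_subset)) ?_ (fun i hi => hc'.2 i ?_) i h
        · rw [Finset.card_union_of_disjoint]
          · have := Finset.card_sdiff_add_card_inter S T
            omega
          · exact (Finset.disjoint_sdiff_inter S T).symm.mono_right hB
        · simp only [Finset.mem_union, Finset.mem_inter] at hi ⊢
          tauto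
    have h3 := Submodule.finrank_mono h2
    -- If `S` already meets `T`, only `δ` symbols are gained but one dimension is saved; it is spent
    -- later on a single symbol.
    have h4 := ih (s + 2 - B.card) (T ∪ S) (by omega)
    have h5 : (T ∪ S).card = T.card + (S \ T).card := by
      rw [← Finset.union_sdiff_self_eq_union, Finset.card_union_of_disjoint Finset.disjoint_sdiff]
    rw [h5] at h4
    rw [Nat.succ_mul]
    omega

/-- The structure of the local sets: when the Singleton-type bound is attained, each of them has
exactly `δ + 1` elements and meets no other one. -/
theorem IsLocalSet.eq_of_mem_of_mem {δ u N : ℕ} (hδ : 2 ≤ δ) (hu : 2 ≤ u)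
    (hN : ∀ T, 1 ≤ finrank K (vanishingSubcode C T) → T.card ≤ N)
    (hloc : ∀ j, ∃ S, j ∈ S ∧ IsLocalSet C δ S) (hk : finrank K C = 2 * u)
    (hNu : N = (u - 1) * (δ + 1) + 1) :
    (∀ S j, j ∈ S → IsLocalSet C δ S → S.card = δ + 1) ∧
    (∀ S S' j, j ∈ S → j ∈ S' → IsLocalSet C δ S → IsLocalSet C δ S' → S = S') := by
  have key := card_add_le_of_finrank_vanishingSubcode (C := C) (by omega : 1 ≤ δ) hN hloc
  obtain ⟨v, rfl⟩ : ∃ v, u = v + 2 := ⟨u - 2, by omega⟩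
  have hNv : N = v * (δ + 1) + δ + 2 := by
    rw [hNu]; simp only [show v + 2 - 1 = v + 1 by omega]; ring
  -- With `f2`: any two coordinates are independent on the code. A repair set of at most `δ` symbols
  -- would be determined by at most one of them, contradicting `f1` or `f2`.
  have f1 : ∀ T : Finset ι, T.Nonempty → finrank K (vanishingSubcode C T) ≤ 2 * v + 3 := by
    intro T hT
    by_contra hlt
    have := key (v + 1) 1 T (by omega)
    rw [Nat.succ_mul] at this
    have := hT.card_pos
    omega
  have f2 : ∀ T : Finset ι, 2 ≤ T.card → finrank K (vanishingSubcode C T) ≤ 2 * v + 2 := by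
    intro T hT
    by_contra hlt
    have := key (v + 1) 0 T (by omega)
    rw [Nat.succ_mul] at this
    omega
  have lower : ∀ A : Finset ι, 2 * (v + 2) ≤ finrank K (vanishingSubcode C A) + A.card := by
    intro A
    have := finrank_vanishingSubcode_le (C := C) ∅ A
    rwa [vanishingSubcode_empty, hk, Finset.empty_union] at this
  have hcard : ∀ S j, j ∈ S → IsLocalSet C δ S → S.card = δ + 1 := by
    intro S j hj hS
    obtain ⟨B, hB, hBc⟩ := Finset.exists_subset_card_eq (s := S) (n := S.card + 1 - δ)
      (by have := Finset.card_pos.2 ⟨j, hj⟩; omega)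
    have h2 : vanishingSubcode C B ≤ vanishingSubcode C S := fun c hc =>
      ⟨hc.1, hS.2 c hc.1 B hB (by omega) hc.2⟩
    have h3 := Submodule.finrank_mono h2
    have h4 := lower B
    have h5 := hS.1
    have h6 := f1 S ⟨j, hj⟩
    have h7 := f2 S
    omega
  refine ⟨hcard, fun S S' j hj hj' hS hS' => ?_⟩
  have hc := hcard S j hj hS
  have hc' := hcard S' j hj' hS'
  have span : ∀ A : Finset ι, 2 ≤ (A ∩ S).card → 2 ≤ (A ∩ S').card →
      vanishingSubcode C A ≤ vanishingSubcode C (S ∪ S') := by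
    intro A h h' c hcA
    refine ⟨hcA.1, fun i hi => ?_⟩
    rcases Finset.mem_union.1 hi with hi | hi
    · exact hS.2 c hcA.1 (A ∩ S) Finset.inter_subset_right (by omega)
        (fun i hi => hcA.2 i (Finset.mem_inter.1 hi).1) i hi
    · exact hS'.2 c hcA.1 (A ∩ S') Finset.inter_subset_right (by omega)
        (fun i hi => hcA.2 i (Finset.mem_inter.1 hi).1) i hi
  -- The common symbol and one more from each set determine the union, which costs only three
  -- dimensions. The overlap then has at least `δ ≥ 2` elements, so two common symbols already
  -- determine both sets, and a second count forces equality.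
  have hun : (S ∪ S').card ≤ δ + 2 := by
    obtain ⟨a, ha, haj⟩ := Finset.exists_mem_ne (by omega : 1 < S.card) j
    obtain ⟨b, hb, hbj⟩ := Finset.exists_mem_ne (by omega : 1 < S'.card) j
    have h1 := Submodule.finrank_mono (span {j, a, b}
      (by
        rw [← Finset.card_pair haj.symm]
        apply Finset.card_le_card
        intro x; simp only [Finset.mem_insert, Finset.mem_singleton, Finset.mem_inter]
        rintro (rfl | rfl) <;> simp [*])
      (by
        rw [← Finset.card_pair hbj.symm]
        apply Finset.card_le_card
        intro x; simp only [Finset.mem_insert, Finset.mem_singleton, Finset.mem_inter]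
        rintro (rfl | rfl) <;> simp [*]))
    have h2 := lower {j, a, b}
    have h3 : ({j, a, b} : Finset ι).card ≤ 3 := Finset.card_le_three
    have := key v 0 (S ∪ S') (by omega)
    omega
  have hin := Finset.card_union_add_card_inter S S'
  obtain ⟨B, hB, hBc⟩ := Finset.exists_subset_card_eq (s := S ∩ S') (n := 2) (by omega)
  have e1 : B ∩ S = B := Finset.inter_eq_left.2 (hB.trans Finset.inter_subset_left)
  have e2 : B ∩ S' = B := Finset.inter_eq_left.2 (hB.trans Finset.inter_subset_right)
  have h1 := Submodule.finrank_mono (span B (by rw [e1]; omega) (by rw [e2]; omega))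
  have h2 := lower B
  have h3 := key v 1 (S ∪ S') (by omega)
  have h4 : S = S ∪ S' := Finset.eq_of_subset_of_card_le Finset.subset_union_left (by omega)
  have h5 : S' = S ∪ S' := Finset.eq_of_subset_of_card_le Finset.subset_union_right (by omega)
  rw [h4, ← h5]

/-! ### The projective line bound -/

/-- A code with `u + 1` local groups of `δ + 1` symbols, of dimension `2 u` and minimum distance
at least `2 δ + 1`, has at most as many symbols as the projective line has points. -/
theorem card_le_card_field_add_one_of_groups [Fintype K] {κ : Type*} [Fintype κ] [DecidableEq κ]
    (g : ι → κ) {δ u : ℕ} (hδ : 1 ≤ δ) (hu : 1 ≤ u) (hκ : Fintype.card κ = u + 1)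
    (hg : ∀ i, (Finset.univ.filter (g · = i)).card = δ + 1)
    (hk : 2 * u ≤ finrank K C)
    (hd : ∀ c ∈ C, ∀ Z : Finset ι, (∀ i ∈ Z, c i = 0) → Fintype.card ι ≤ Z.card + 2 * δ → c = 0)
    (hloc : ∀ i, ∃ a b, a ≠ b ∧ g a = i ∧ g b = i ∧
      ∀ c ∈ C, c a = 0 → c b = 0 → ∀ j, g j = i → c j = 0) :
    Fintype.card ι ≤ Fintype.card K + 1 := by
  choose a b hab ha hb hv using hloc
  obtain ⟨p, q, hpq⟩ : ∃ p q : κ, p ≠ q := Fintype.exists_pair_of_one_lt_card (by omega)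
  -- Two groups have `2δ + 2` places, so two zeros among them leave weight at most `2δ`.
  have two : ∀ c ∈ C, ∀ i i' : κ, i ≠ i' → (∀ j, g j ≠ i → g j ≠ i' → c j = 0) →
      ∀ x y, x ≠ y → (g x = i ∨ g x = i') → (g y = i ∨ g y = i') → c x = 0 → c y = 0 →
      c = 0 := by
    intro c hc i i' hii h x y hxy hgx hgy hx hy
    let U := Finset.univ.filter (g · = i) ∪ Finset.univ.filter (g · = i')
    have hU : U.card = 2 * δ + 2 := by
      rw [Finset.card_union_of_disjoint, hg, hg]
      · ring
      · rw [Finset.disjoint_filter]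
        intro j _ h1 h2
        exact hii (h1.symm.trans h2)
    have hxyU : {x, y} ⊆ U := by
      intro j hj
      rcases Finset.mem_insert.1 hj with rfl | hj
      · simpa [U] using hgx
      · rw [Finset.mem_singleton.1 hj]; simpa [U] using hgy
    refine hd c hc (U \ {x, y})ᶜ (fun j hj => ?_) ?_
    · by_cases hjx : j = x
      · rwa [hjx]
      by_cases hjy : j = y
      · rwa [hjy]
      have : ¬ (g j = i ∨ g j = i') := by simpa [U, hjx, hjy] using hj
      exact h j (fun h => this (Or.inl h)) (fun h => this (Or.inr h))
    · rw [Finset.card_compl, Finset.card_sdiff_of_subset hxyU, Finset.card_pair hxy, hU]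
      omega
  have ex : ∀ j : ι, ∃ i, i ≠ p ∧ (g j = p ∨ g j = i) := by
    intro j
    by_cases h : g j = p
    · exact ⟨q, hpq.symm, Or.inl h⟩
    · exact ⟨g j, h, Or.inr rfl⟩
  choose γ hγp hγ using ex
  -- Killing the other `u - 1` groups takes two conditions each, and `j` one more: `2u - 1` in all,
  -- one below the dimension.
  have exw : ∀ j : ι, ∃ c ∈ C, c ≠ 0 ∧ c j = 0 ∧ ∀ x, g x ≠ p → g x ≠ γ j → c x = 0 := by
    intro j
    let I : Finset κ := Finset.univ \ {p, γ j}
    let T : Finset ι := {j} ∪ (I.image a ∪ I.image b)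
    have hI : I.card = u - 1 := by
      rw [Finset.card_sdiff_of_subset (Finset.subset_univ _), Finset.card_pair (hγp j).symm,
        Finset.card_univ, hκ]
      omega
    have hT : T.card ≤ 1 + ((u - 1) + (u - 1)) := by
      refine (Finset.card_union_le _ _).trans ?_
      gcongr
      · simp
      · refine (Finset.card_union_le _ _).trans ?_
        gcongr <;> exact Finset.card_image_le.trans hI.le
    have h1 := finrank_vanishingSubcode_le (C := C) ∅ T
    rw [vanishingSubcode_empty, Finset.empty_union] at h1
    obtain ⟨c, hc, h0, i, hi⟩ := exists_ne_zero_of_one_le_finrank (C := C) (T := T) (by omega)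
    refine ⟨c, hc, fun h => hi (by simp [h]), h0 j (by simp [T]), fun x hx hx' => ?_⟩
    have hxI : g x ∈ I := by simp [I, hx, hx']
    exact hv (g x) c hc
      (h0 _ (Finset.mem_union_right _ (Finset.mem_union_left _ (Finset.mem_image_of_mem a hxI))))
      (h0 _ (Finset.mem_union_right _ (Finset.mem_union_right _ (Finset.mem_image_of_mem b hxI))))
      x rfl
  choose w hwC hw0 hwj hwv using exw
  have wne : ∀ j x, x ≠ j → (g x = p ∨ g x = γ j) → w j x ≠ 0 := fun j x hx hgx h =>
    hw0 j (two (w j) (hwC j) p (γ j) (hγp j).symm (hwv j) x j hx hgx (hγ j) h (hwj j))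
  have wab : ∀ j, w j (b p) = 0 → w j (a p) ≠ 0 := fun j h h' =>
    hw0 j (two (w j) (hwC j) p (γ j) (hγp j).symm (hwv j) _ _ (hab p) (Or.inl (ha p))
      (Or.inl (hb p)) h' h)
  have main : ∀ j j', j ≠ j' → ∀ s t : K, s ≠ 0 → t ≠ 0 → s * w j (a p) = t * w j' (a p) →
      s * w j (b p) = t * w j' (b p) → False := by
    intro j j' hjj s t hs ht h1 h2
    have hcC : s • w j - t • w j' ∈ C := C.sub_mem (C.smul_mem s (hwC j)) (C.smul_mem t (hwC j'))
    have hca : (s • w j - t • w j') (a p) = 0 := by simp [h1]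
    have hcb : (s • w j - t • w j') (b p) = 0 := by simp [h2]
    have hcp := hv p _ hcC hca hcb
    -- Proportional words would have equal zero sets. But inside its two groups `w j` vanishes only
    -- at `j`, and the group of `j` has another place.
    have zero_of_zero : s • w j - t • w j' = 0 → False := by
      intro h0
      have h3 : ∀ x, s * w j x = t * w j' x := fun x => by
        simpa [sub_eq_zero] using congrFun h0 x
      have h4 : w j' j = 0 := by simpa [hwj j, ht] using (h3 j).symm
      have h5 : ¬ (g j = p ∨ g j = γ j') := fun h => wne j' j hjj h h4
      push Not at h5
      have h6 : g j = γ j := (hγ j).resolve_left h5.1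
      obtain ⟨x, hxj, hx⟩ : ∃ x, x ≠ j ∧ g x = g j := by
        by_cases h : a (g j) = j
        · exact ⟨b (g j), fun h' => hab _ (h.trans h'.symm), hb _⟩
        · exact ⟨a (g j), h, ha _⟩
      have h7 := h3 x
      rw [hwv j' x (hx ▸ h5.1) (hx ▸ h5.2), mul_zero] at h7
      exact wne j x hxj (Or.inr (hx.trans h6)) ((mul_eq_zero.1 h7).resolve_left hs)
    apply zero_of_zero
    by_cases hγγ : γ j = γ j'
    · refine two _ hcC p (γ j) (hγp j).symm (fun x hx hx' => ?_) _ _ (hab p) (Or.inl (ha p))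
        (Or.inl (hb p)) hca hcb
      simp [hwv j x hx hx', hwv j' x hx (hγγ ▸ hx')]
    -- With distinct second groups, the difference vanishes on `p`, which excludes `j` and `j'` from
    -- `p`. It then lives on `γ j` and `γ j'` and vanishes at `j` and `j'`.
    have hj : g j ≠ p := by
      intro h
      have h3 := hcp j h
      simp only [Pi.sub_apply, Pi.smul_apply, smul_eq_mul, hwj j, mul_zero, zero_sub,
        neg_eq_zero, mul_eq_zero, ht, false_or] at h3
      exact wne j' j hjj (Or.inl h) h3
    have hj' : g j' ≠ p := by
      intro h
      have h3 := hcp j' h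
      simp only [Pi.sub_apply, Pi.smul_apply, smul_eq_mul, hwj j', mul_zero, sub_zero,
        mul_eq_zero, hs, false_or] at h3
      exact wne j j' hjj.symm (Or.inl h) h3
    have e := (hγ j).resolve_left hj
    have e' := (hγ j').resolve_left hj'
    refine two _ hcC (γ j) (γ j') hγγ (fun x hx hx' => ?_) j j' hjj (Or.inl e) (Or.inr e') ?_ ?_
    · by_cases hxp : g x = p
      · exact hcp x hxp
      · simp [hwv j x hxp hx, hwv j' x hxp hx']
    · simp [hwj j, hwv j' j hj (e ▸ hγγ)]
    · simp [hwj j', hwv j j' hj' (e' ▸ Ne.symm hγγ)]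
  classical
  -- `Option K` is the projective line, with `none` at infinity; by `wab` the two coordinates are
  -- never both zero.
  let φ : ι → Option K := fun j => if w j (b p) = 0 then none else some (w j (a p) / w j (b p))
  have hφ : Function.Injective φ := by
    intro j j' h
    by_contra hjj
    by_cases h1 : w j (b p) = 0 <;> by_cases h2 : w j' (b p) = 0 <;> simp [φ, h1, h2] at h
    · exact main j j' hjj _ _ (wab j' h2) (wab j h1) (mul_comm _ _) (by simp [h1, h2])
    · rw [div_eq_div_iff h1 h2] at h
      exact main j j' hjj _ _ h2 h1 (by rw [mul_comm, h, mul_comm]) (mul_comm _ _)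
  simpa using Fintype.card_le_of_injective φ hφ

end Bound

/-! ### From minimum distance and locality to the length bound -/

theorem minDist_le_hammingNorm {F ι : Type*} [Field F] [Fintype ι] [DecidableEq F]
    {C : Submodule F (ι → F)} {c : ι → F} (hc : c ∈ C) (h0 : c ≠ 0) :
    minDist C ≤ hammingNorm c := by
  refine (iInf₂_le c hc).trans ((iInf₂_le 0 C.zero_mem).trans ((iInf_le _ h0).trans (le_of_eq ?_)))
  rw [← hammingDist_zero_right]
  congr

theorem le_minDist {F ι : Type*} [Field F] [Fintype ι] [DecidableEq F]
    {C : Submodule F (ι → F)} {d : ℕ} (h : ∀ c ∈ C, c ≠ 0 → d ≤ hammingNorm c) :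
    (d : ℕ∞) ≤ minDist C := by
  refine le_iInf₂ fun x hx => le_iInf₂ fun y hy => le_iInf fun hxy => ?_
  have := h (x - y) (C.sub_mem hx hy) (sub_ne_zero.2 hxy)
  refine (Nat.cast_le.2 this).trans (le_of_eq ?_)
  simp only [hammingNorm, hammingDist, Pi.sub_apply, sub_ne_zero]

theorem hammingNorm_add_card_le {F ι : Type*} [Field F] [Fintype ι] [DecidableEq F]
    {c : ι → F} {Z : Finset ι} (hZ : ∀ i ∈ Z, c i = 0) :
    hammingNorm c + Z.card ≤ Fintype.card ι := by
  classical
  rw [hammingNorm, ← Finset.card_univ, ← Finset.card_union_of_disjoint]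
  · exact Finset.card_le_card (Finset.subset_univ _)
  · rw [Finset.disjoint_left]
    intro i hi hiZ
    exact (Finset.mem_filter.1 hi).2 (hZ i hiZ)

theorem eq_zero_of_le_minDist {F ι : Type*} [Field F] [Fintype ι] {C : Submodule F (ι → F)}
    {d : ℕ} (hd : (d : ℕ∞) ≤ minDist C) {c : ι → F} (hc : c ∈ C) {Z : Finset ι}
    (hZ : ∀ i ∈ Z, c i = 0) (h : Fintype.card ι < Z.card + d) : c = 0 := by
  classical
  by_contra h0
  have h1 : d ≤ hammingNorm c := by exact_mod_cast hd.trans (minDist_le_hammingNorm hc h0)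
  have := hammingNorm_add_card_le hZ
  omega

theorem IsRepairSet.isLocalSet {F : Type*} [Field F] {n δ : ℕ} {C : Submodule F (Fin n → F)}
    {j : Fin n} {S : Finset (Fin n)} (h : IsRepairSet C 2 δ j S) : IsLocalSet C δ S := by
  refine ⟨by have := h.2.1; omega, fun c hc Z hZS hcard hZ i hi => ?_⟩
  have key := eq_zero_of_le_minDist h.2.2 (c := fun i : S => c i) ⟨c, hc, rfl⟩
    (Z := Z.subtype (· ∈ S)) (fun i hi => hZ i (by simpa using hi)) (by
      rw [Finset.card_subtype, Finset.filter_true_of_mem (fun x hx => hZS hx), Fintype.card_coe]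
      exact hcard)
  exact congrFun key ⟨i, hi⟩

theorem IsOptimalLRC.dist_eq {F : Type*} [Field F] {n δ u d : ℕ} {C : Submodule F (Fin n → F)}
    (hn : n = (u + 1) * (δ + 1)) (h : IsOptimalLRC C (2 * u) d 2 δ) : d = 2 * δ + 1 := by
  have h1 := h.optimal
  have h2 : ((2 * u : ℕ) : ℚ) / ((2 : ℕ) : ℚ) = ((u : ℤ) : ℚ) := by push_cast; field_simp
  rw [h2, Int.ceil_intCast, hn] at h1
  push_cast at h1
  have : (d : ℤ) = 2 * δ + 1 := by rw [h1]; ring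
  exact_mod_cast this

theorem IsOptimalLRC.length_le_card_add_one {K : Type*} [Field K] [Fintype K] {n δ u d : ℕ}
    {C : Submodule K (Fin n → K)} (hδ : 1 ≤ δ) (hu : 1 ≤ u) (hn : n = (u + 1) * (δ + 1))
    (h : IsOptimalLRC C (2 * u) d 2 δ) : n ≤ Fintype.card K + 1 := by
  have hd := h.dist_eq hn
  have hzero : ∀ c ∈ C, ∀ Z : Finset (Fin n), (∀ i ∈ Z, c i = 0) →
      Fintype.card (Fin n) ≤ Z.card + 2 * δ → c = 0 := fun c hc Z hZ hcard =>
    eq_zero_of_le_minDist (d := d) h.minDist_eq.ge hc hZ (by omega)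
  suffices ∃ (κ : Type) (_ : Fintype κ) (_ : DecidableEq κ) (g : Fin n → κ),
      Fintype.card κ = u + 1 ∧ (∀ i, (Finset.univ.filter (g · = i)).card = δ + 1) ∧
      ∀ i, ∃ a b, a ≠ b ∧ g a = i ∧ g b = i ∧
        ∀ c ∈ C, c a = 0 → c b = 0 → ∀ j, g j = i → c j = 0 by
    obtain ⟨κ, _, _, g, h1, h2, h3⟩ := this
    simpa using card_le_card_field_add_one_of_groups g hδ hu h1 h2 h.dim_eq.ge hzero h3
  have pair : ∀ {κ : Type} [DecidableEq κ] (g : Fin n → κ) (i : κ),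
      (Finset.univ.filter (g · = i)).card = δ + 1 → ∃ a b, a ≠ b ∧ g a = i ∧ g b = i := by
    intro κ _ g i hi
    obtain ⟨a, ha, b, hb, hab⟩ := Finset.one_lt_card.1 (by omega :
      1 < (Finset.univ.filter (g · = i)).card)
    exact ⟨a, b, hab, by simpa using ha, by simpa using hb⟩
  -- These are the MDS cases, where repair sets need not be disjoint. Any partition into groups of
  -- size `δ + 1` serves: for `u = 1` two zeros kill a word, and for `δ = 1` two symbols are a whole
  -- group.
  by_cases hmds : u = 1 ∨ δ = 1
  · let e : Fin n ≃ Fin (u + 1) × Fin (δ + 1) := (finCongr hn).trans finProdFinEquiv.symm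
    have hfib : ∀ i, (Finset.univ.filter (fun j => (e j).1 = i)).card = δ + 1 := by
      intro i
      have : Finset.univ.filter (fun j => (e j).1 = i) =
          Finset.univ.image (fun x : Fin (δ + 1) => e.symm (i, x)) := by
        ext j
        simp only [Finset.mem_filter, Finset.mem_univ, true_and, Finset.mem_image,
          Equiv.symm_apply_eq]
        exact ⟨fun h => ⟨(e j).2, by rw [← h]⟩, fun ⟨x, hx⟩ => by rw [← hx]⟩
      rw [this, Finset.card_image_of_injective _ (fun x y hxy => by simpa using hxy),
        Finset.card_univ, Fintype.card_fin]
    refine ⟨Fin (u + 1), inferInstance, inferInstance, fun j => (e j).1, by simp, hfib, fun i => ?_⟩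
    obtain ⟨a, b, hab, ha, hb⟩ := pair (fun j => (e j).1) i (hfib i)
    refine ⟨a, b, hab, ha, hb, fun c hc hca hcb j hj => ?_⟩
    rcases hmds with rfl | rfl
    · rw [hzero c hc {a, b} (by simp [hca, hcb]) (by
        rw [Finset.card_pair hab, Fintype.card_fin, hn]; omega)]
      rfl
    · have hab' : {a, b} = Finset.univ.filter (fun j => (e j).1 = i) :=
        Finset.eq_of_subset_of_card_le (by
          intro x hx
          rcases Finset.mem_insert.1 hx with rfl | hx
          · simpa using ha
          · rw [Finset.mem_singleton.1 hx]; simpa using hb) (by rw [hfib, Finset.card_pair hab])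
      have : j ∈ ({a, b} : Finset (Fin n)) := by rw [hab']; simpa using hj
      rcases Finset.mem_insert.1 this with rfl | hx
      · exact hca
      · rwa [Finset.mem_singleton.1 hx]
  · push Not at hmds
    have hN : ∀ T, 1 ≤ finrank K (vanishingSubcode C T) → T.card ≤ (u - 1) * (δ + 1) + 1 := by
      intro T hT
      by_contra hlt
      obtain ⟨c, hc, h0, i, hi⟩ := exists_ne_zero_of_one_le_finrank hT
      refine hi ?_
      rw [hzero c hc T h0]
      · rfl
      · rw [Fintype.card_fin]
        refine hn.le.trans ?_
        obtain ⟨v, rfl⟩ : ∃ v, u = v + 1 := ⟨u - 1, by omega⟩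
        simp only [Nat.add_sub_cancel] at hlt
        rw [Nat.succ_mul, Nat.succ_mul]
        omega
    choose S hS using h.locality
    have hSl : ∀ j, IsLocalSet C δ (S j) := fun j => (hS j).isLocalSet
    obtain ⟨hcard, heq⟩ := IsLocalSet.eq_of_mem_of_mem (by omega : 2 ≤ δ) (by omega : 2 ≤ u) hN
      (fun j => ⟨S j, (hS j).1, hSl j⟩) h.dim_eq rfl
    have hmem : ∀ i j, S j = S i ↔ j ∈ S i := fun i j =>
      ⟨fun h => h ▸ (hS j).1, fun hj => heq _ _ j (hS j).1 hj (hSl j) (hSl i)⟩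
    let g : Fin n → Set.range S := fun j => ⟨S j, j, rfl⟩
    have hg : ∀ i, (Finset.univ.filter (g · = i)).card = δ + 1 := by
      rintro ⟨_, i, rfl⟩
      refine Eq.trans (congrArg Finset.card ?_) (hcard _ i (hS i).1 (hSl i))
      ext j
      rw [Finset.mem_filter]
      exact ⟨fun h => (hmem i j).1 (congrArg Subtype.val h.2),
        fun h => ⟨Finset.mem_univ _, Subtype.ext ((hmem i j).2 h)⟩⟩
    refine ⟨Set.range S, Fintype.ofFinite _, inferInstance, g, ?_, hg, ?_⟩
    · let := Fintype.ofFinite (Set.range S)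
      have h1 := Finset.card_eq_sum_card_fiberwise (f := g) (s := Finset.univ)
        (t := Finset.univ) (by simp)
      simp only [hg, Finset.card_univ, Fintype.card_fin, Finset.sum_const, smul_eq_mul] at h1
      exact Nat.eq_of_mul_eq_mul_right (Nat.succ_pos δ) (h1.symm.trans hn)
    · intro i
      obtain ⟨a, b, hab, ha, hb⟩ := pair g i (hg i)
      refine ⟨a, b, hab, ha, hb, fun c hc hca hcb j hj => ?_⟩
      subst hj
      have ha' : a ∈ S j := (hmem j a).1 (congrArg Subtype.val ha)
      have hb' : b ∈ S j := (hmem j b).1 (congrArg Subtype.val hb)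
      refine (hSl j).2 c hc {a, b} ?_ ?_ ?_ j (hS j).1
      · simp [Finset.insert_subset_iff, ha', hb']
      · rw [Finset.card_pair hab, hcard _ j (hS j).1 (hSl j)]; omega
      · simp [hca, hcb]

theorem card_le_hammingNorm_add_one {F ι : Type*} [Field F] [Fintype ι] [DecidableEq F]
    {c : ι → F} (h : ∀ i j, c i = 0 → c j = 0 → i = j) :
    Fintype.card ι ≤ hammingNorm c + 1 := by
  classical
  have h1 : (Finset.univ.filter (fun i => ¬ c i ≠ 0)).card ≤ 1 := by
    rw [Finset.card_le_one]
    intro a ha b hb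
    exact h a b (by simpa using ha) (by simpa using hb)
  have h2 := Finset.card_filter_add_card_filter_not (s := (Finset.univ : Finset ι))
    (fun i => c i ≠ 0)
  rw [Finset.card_univ] at h2
  rw [hammingNorm]
  omega

/-! ### Codes from zero-sum families in a plane -/

section Construction

variable {F E κ ι : Type*} [Field F] [AddCommGroup E] [Module F E] [Fintype κ]

/-- The code of the words `(ℓ j (v (g j)))_j` for the families `v` of sum zero. -/
def groupCode (g : ι → κ) (ℓ : ι → E →ₗ[F] F) : Submodule F (ι → F) :=
  (LinearMap.ker (∑ i : κ, LinearMap.proj i : (κ → E) →ₗ[F] E)).map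
    (LinearMap.pi fun j => ℓ j ∘ₗ LinearMap.proj (g j))

theorem mem_groupCode {g : ι → κ} {ℓ : ι → E →ₗ[F] F} {c : ι → F} :
    c ∈ groupCode g ℓ ↔ ∃ v : κ → E, ∑ i, v i = 0 ∧ ∀ j, ℓ j (v (g j)) = c j := by
  simp [groupCode, funext_iff]

variable [Fintype ι] {g : ι → κ} {ℓ : ι → E →ₗ[F] F} {δ u : ℕ}

theorem finrank_groupCode [DecidableEq κ] [FiniteDimensional F E] (hE : finrank F E = 2)
    (hκ : Fintype.card κ = u + 1) (hδ : 1 ≤ δ)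
    (hg : ∀ i, (Finset.univ.filter (g · = i)).card = δ + 1)
    (hℓ : ∀ j j' v, j ≠ j' → ℓ j v = 0 → ℓ j' v = 0 → v = 0) :
    finrank F (groupCode g ℓ) = 2 * u := by
  have hinj : Function.Injective
      (LinearMap.pi fun j => ℓ j ∘ₗ LinearMap.proj (g j) : (κ → E) →ₗ[F] (ι → F)) := by
    rw [← LinearMap.ker_eq_bot, LinearMap.ker_eq_bot']
    intro v hv
    funext i
    obtain ⟨a, ha, b, hb, hab⟩ := Finset.one_lt_card.1 (by rw [hg]; omega :
      1 < (Finset.univ.filter (g · = i)).card)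
    have ha' : g a = i := by simpa using ha
    have hb' : g b = i := by simpa using hb
    have h1 := congrFun hv a
    have h2 := congrFun hv b
    simp only [LinearMap.pi_apply, LinearMap.comp_apply, LinearMap.proj_apply, ha', hb',
      Pi.zero_apply] at h1 h2
    exact hℓ a b _ hab h1 h2
  rw [groupCode, LinearEquiv.finrank_eq (Submodule.equivMapOfInjective _ hinj _).symm]
  have hsurj : Function.Surjective (∑ i : κ, LinearMap.proj i : (κ → E) →ₗ[F] E) := by
    obtain ⟨i⟩ : Nonempty κ := Fintype.card_pos_iff.1 (by omega)
    intro x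
    exact ⟨Pi.single i x, by simp⟩
  have h1 := LinearMap.finrank_range_add_finrank_ker
    (∑ i : κ, LinearMap.proj i : (κ → E) →ₗ[F] E)
  rw [LinearMap.range_eq_top.2 hsurj, finrank_top, hE, finrank_pi_fintype] at h1
  simp only [hE, Finset.sum_const, Finset.card_univ, hκ, smul_eq_mul] at h1
  omega

/-- A nonzero vector is killed by at most one form. Sum zero excludes a single active group. Two
active groups carry opposite vectors, hence at most one zero between them and weight at least `2(δ +
1) - 1`. Three or more give at least `3δ ≥ 2δ + 1`. -/
theorem le_hammingNorm_of_mem_groupCode [DecidableEq F] [DecidableEq κ] (hδ : 1 ≤ δ)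
    (hg : ∀ i, (Finset.univ.filter (g · = i)).card = δ + 1)
    (hℓ : ∀ j j' v, j ≠ j' → ℓ j v = 0 → ℓ j' v = 0 → v = 0) {c : ι → F}
    (hc : c ∈ groupCode g ℓ) (h0 : c ≠ 0) : 2 * δ + 1 ≤ hammingNorm c := by
  classical
  obtain ⟨v, hv, hvc⟩ := mem_groupCode.1 hc
  let I : Finset κ := Finset.univ.filter (fun i => v i ≠ 0)
  have hI : ∀ i, i ∈ I ↔ v i ≠ 0 := fun i => by simp [I]
  have hsum : ∑ i ∈ I, v i = 0 := by rw [← hv, Finset.sum_filter_ne_zero]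
  let w : κ → ℕ := fun i => ((Finset.univ.filter (fun j => c j ≠ 0)).filter (g · = i)).card
  have hnorm : hammingNorm c = ∑ i, w i :=
    Finset.card_eq_sum_card_fiberwise (f := g) (t := Finset.univ) (by simp)
  have hle : ∑ i ∈ I, w i ≤ hammingNorm c := by
    rw [hnorm]
    exact Finset.sum_le_sum_of_subset (Finset.subset_univ _)
  have hsplit : ∀ i, δ + 1 =
      w i + ((Finset.univ.filter (fun j => c j = 0)).filter (g · = i)).card := by
    intro i
    rw [← hg i, ← Finset.card_filter_add_card_filter_not (fun j => c j ≠ 0)]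
    congr 2
    · rw [Finset.filter_comm]
    · simp only [not_not]; rw [Finset.filter_comm]
  have hone : ∀ i ∈ I, ∀ i' ∈ I, (v i = v i' ∨ v i = - v i') →
      ∀ j j', c j = 0 → c j' = 0 → g j = i → g j' = i' → j = j' := by
    intro i hi i' hi' hvv j j' hj hj' rfl rfl
    by_contra hne
    rw [← hvc] at hj hj'
    refine (hI _).1 hi (hℓ j j' _ hne hj ?_)
    rcases hvv with h | h <;> simp [h, hj']
  have hw : ∀ i ∈ I, δ ≤ w i := by
    intro i hi
    have h1 := hsplit i
    have h2 : ((Finset.univ.filter (fun j => c j = 0)).filter (g · = i)).card ≤ 1 := by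
      rw [Finset.card_le_one]
      intro a ha b hb
      simp only [Finset.mem_filter, Finset.mem_univ, true_and] at ha hb
      exact hone i hi i hi (Or.inl rfl) a b ha.1 hb.1 ha.2 hb.2
    omega
  have hIne : I.Nonempty := by
    by_contra hne
    rw [Finset.not_nonempty_iff_eq_empty] at hne
    apply h0
    funext j
    have : v (g j) = 0 := by
      by_contra h
      simpa [hne] using (hI _).2 h
    rw [← hvc, this, map_zero, Pi.zero_apply]
  have hcard : I.card = 1 ∨ I.card = 2 ∨ 3 ≤ I.card := by
    have := hIne.card_pos
    omega
  rcases hcard with h | h | h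
  · obtain ⟨i, hi⟩ := Finset.card_eq_one.1 h
    rw [hi, Finset.sum_singleton] at hsum
    exact absurd hsum ((hI i).1 (by simp [hi]))
  · obtain ⟨i, i', hii, hi⟩ := Finset.card_eq_two.1 h
    rw [hi, Finset.sum_pair hii] at hsum hle
    have hiI : i ∈ I := by simp [hi]
    have hiI' : i' ∈ I := by simp [hi]
    have h1 := hsplit i
    have h2 := hsplit i'
    have h3 : ((Finset.univ.filter (fun j => c j = 0)).filter (g · = i)).card +
        ((Finset.univ.filter (fun j => c j = 0)).filter (g · = i')).card ≤ 1 := by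
      rw [← Finset.card_union_of_disjoint, Finset.card_le_one]
      · intro a ha b hb
        simp only [Finset.mem_union, Finset.mem_filter, Finset.mem_univ, true_and] at ha hb
        rcases ha with ha | ha <;> rcases hb with hb | hb
        · exact hone i hiI i hiI (Or.inl rfl) a b ha.1 hb.1 ha.2 hb.2
        · exact hone i hiI i' hiI' (Or.inr (eq_neg_of_add_eq_zero_left hsum)) a b ha.1 hb.1 ha.2
            hb.2
        · exact (hone i hiI i' hiI' (Or.inr (eq_neg_of_add_eq_zero_left hsum)) b a hb.1 ha.1 hb.2
            ha.2).symm
        · exact hone i' hiI' i' hiI' (Or.inl rfl) a b ha.1 hb.1 ha.2 hb.2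
      · rw [Finset.disjoint_filter]
        intro j _ h4 h5
        exact hii (h4.symm.trans h5)
    omega
  · have h1 : I.card * δ ≤ ∑ i ∈ I, w i := by
      simpa using Finset.card_nsmul_le_sum I w δ hw
    have h2 : 3 * δ ≤ I.card * δ := Nat.mul_le_mul_right δ h
    omega

theorem exists_mem_groupCode_hammingNorm_le [DecidableEq F] [DecidableEq κ]
    [FiniteDimensional F E] (hE : finrank F E = 2)
    (hδ : 1 ≤ δ) (hu : 1 ≤ u) (hκ : Fintype.card κ = u + 1)
    (hg : ∀ i, (Finset.univ.filter (g · = i)).card = δ + 1)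
    (hℓ : ∀ j j' v, j ≠ j' → ℓ j v = 0 → ℓ j' v = 0 → v = 0) :
    ∃ c ∈ groupCode g ℓ, c ≠ 0 ∧ hammingNorm c ≤ 2 * δ + 1 := by
  classical
  obtain ⟨i, i', hii⟩ := Fintype.exists_pair_of_one_lt_card (by omega : 1 < Fintype.card κ)
  obtain ⟨a, ha, b, hb, hab⟩ := Finset.one_lt_card.1 (by rw [hg]; omega :
      1 < (Finset.univ.filter (g · = i)).card)
  have ha' : g a = i := by simpa using ha
  have hb' : g b = i := by simpa using hb
  obtain ⟨x, hx, hx0⟩ : ∃ x ∈ LinearMap.ker (ℓ a), x ≠ 0 := by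
    apply Submodule.exists_mem_ne_zero_of_ne_bot
    apply LinearMap.ker_ne_bot_of_finrank_lt
    rw [hE, finrank_self]; omega
  -- Opposite vectors in two groups, chosen in the kernel of one form, so that one of the `2δ + 2`
  -- symbols vanishes.
  let v : κ → E := Pi.single i x - Pi.single i' x
  have hva : v i = x := by simp [v, hii]
  have hv0 : ∀ k, k ≠ i → k ≠ i' → v k = 0 := fun k h h' => by simp [v, h, h']
  refine ⟨fun j => ℓ j (v (g j)), mem_groupCode.2 ⟨v, by simp [v, Finset.sum_sub_distrib],
    fun _ => rfl⟩, fun h => ?_, ?_⟩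
  · have h1 := congrFun h b
    simp only [hb', hva, Pi.zero_apply] at h1
    exact hx0 (hℓ a b x hab hx h1)
  · have hsub : Finset.univ.filter (fun j => ℓ j (v (g j)) ≠ 0) ⊆
        (Finset.univ.filter (g · = i) ∪ Finset.univ.filter (g · = i')).erase a := by
      intro j hj
      simp only [Finset.mem_filter, Finset.mem_univ, true_and, Finset.mem_erase,
        Finset.mem_union] at hj ⊢
      refine ⟨?_, ?_⟩
      · rintro rfl
        rw [ha', hva] at hj
        exact hj hx
      · by_contra hcon
        push Not at hcon
        exact hj (by rw [hv0 _ hcon.1 hcon.2, map_zero])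
    refine (Finset.card_le_card hsub).trans ?_
    rw [Finset.card_erase_of_mem (Finset.mem_union_left _ ha)]
    have := Finset.card_union_le (Finset.univ.filter (g · = i)) (Finset.univ.filter (g · = i'))
    rw [hg, hg] at this
    omega

end Construction

theorem isOptimalLRC_groupCode {F E κ : Type*} [Field F] [AddCommGroup E] [Module F E]
    [FiniteDimensional F E] [Fintype κ] [DecidableEq κ] {n δ u : ℕ} {g : Fin n → κ}
    {ℓ : Fin n → E →ₗ[F] F} (hE : finrank F E = 2) (hδ : 1 ≤ δ) (hu : 1 ≤ u)
    (hn : n = (u + 1) * (δ + 1)) (hκ : Fintype.card κ = u + 1)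
    (hg : ∀ i, (Finset.univ.filter (g · = i)).card = δ + 1)
    (hℓ : ∀ j j' v, j ≠ j' → ℓ j v = 0 → ℓ j' v = 0 → v = 0) :
    IsOptimalLRC (groupCode g ℓ) (2 * u) (2 * δ + 1) 2 δ := by
  classical
  refine ⟨finrank_groupCode hE hκ hδ hg hℓ, le_antisymm ?_ ?_, fun j => ?_, ?_⟩
  · obtain ⟨c, hc, h0, hle⟩ := exists_mem_groupCode_hammingNorm_le hE hδ hu hκ hg hℓ
    exact (minDist_le_hammingNorm hc h0).trans (by exact_mod_cast hle)
  · exact le_minDist fun c hc h0 => le_hammingNorm_of_mem_groupCode hδ hg hℓ hc h0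
  · refine ⟨Finset.univ.filter (g · = g j), by simp, by rw [hg]; omega, le_minDist ?_⟩
    rintro _ ⟨c, hc, rfl⟩ h0
    obtain ⟨v, -, hvc⟩ := mem_groupCode.1 hc
    have hval : ∀ i : Finset.univ.filter (g · = g j),
        LinearMap.funLeft F F (Subtype.val : Finset.univ.filter (g · = g j) → Fin n) c i =
          ℓ i (v (g j)) := by
      intro i
      have : g i = g j := (Finset.mem_filter.1 i.2).2
      rw [LinearMap.funLeft_apply, ← hvc, this]
    have hv : v (g j) ≠ 0 := by
      intro h
      apply h0
      funext i
      rw [hval, h, map_zero, Pi.zero_apply]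
    have := card_le_hammingNorm_add_one
      (c := LinearMap.funLeft F F (Subtype.val : Finset.univ.filter (g · = g j) → Fin n) c) (by
        intro a b ha hb
        rw [hval] at ha hb
        by_contra hab
        exact hv (hℓ a b _ (fun h => hab (Subtype.ext h)) ha hb))
    rw [Fintype.card_coe, hg] at this
    omega
  · have h2 : ((2 * u : ℕ) : ℚ) / ((2 : ℕ) : ℚ) = ((u : ℤ) : ℚ) := by push_cast; field_simp
    rw [h2, Int.ceil_intCast, hn]
    push_cast
    ring

/-- The shift permutes the groups by `τ` and is absorbed by applying `A` to every vector, which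
preserves sum zero. -/
theorem isCyclicCode_groupCode {F E κ : Type*} [Field F] [AddCommGroup E] [Module F E]
    [Fintype κ] {n : ℕ} {g : Fin n → κ} {ℓ : Fin n → E →ₗ[F] F} (τ : κ ≃ κ) (A : E →ₗ[F] E)
    (hτ : ∀ j, g (finRotate n j) = τ (g j)) (hA : ∀ j v, ℓ (finRotate n j) (A v) = ℓ j v) :
    IsCyclicCode (groupCode g ℓ) := by
  intro c hc
  obtain ⟨v, hv, hvc⟩ := mem_groupCode.1 hc
  refine mem_groupCode.2 ⟨fun i => A (v (τ.symm i)), ?_, fun j => ?_⟩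
  · rw [← map_sum, Equiv.sum_comp τ.symm v, hv, map_zero]
  · obtain ⟨k, rfl⟩ := (finRotate n).surjective j
    rw [hτ, hA, Equiv.symm_apply_apply, Equiv.symm_apply_apply, hvc]

theorem Function.Periodic.apply_finRotate {α : Type*} {n : ℕ} {f : ℕ → α}
    (hf : Function.Periodic f n) (j : Fin n) : f (finRotate n j) = f (j + 1) := by
  cases n with
  | zero => exact j.elim0
  | succ n => rw [finRotate_apply, Fin.val_add, Fin.val_one', Nat.add_mod_mod, hf.map_mod_nat]

theorem card_filter_natCast_eq {n m δ : ℕ} [NeZero m] (hn : n = m * (δ + 1)) (i : ZMod m) :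
    (Finset.univ.filter (fun j : Fin n => ((j : ℕ) : ZMod m) = i)).card = δ + 1 := by
  have hlt : ∀ x : Fin (δ + 1), i.val + m * x < n := fun x => by
    have h1 := ZMod.val_lt i
    have h2 : m * (x + 1) ≤ m * (δ + 1) := Nat.mul_le_mul_left m x.2
    rw [Nat.mul_succ] at h2
    omega
  have hm : 0 < m := Nat.pos_of_neZero m
  have : Finset.univ.filter (fun j : Fin n => ((j : ℕ) : ZMod m) = i) =
      Finset.univ.image (fun x : Fin (δ + 1) => (⟨i.val + m * x, hlt x⟩ : Fin n)) := by
    ext j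
    simp only [Finset.mem_filter, Finset.mem_univ, true_and, Finset.mem_image]
    constructor
    · rintro rfl
      refine ⟨⟨j / m, ?_⟩, ?_⟩
      · rw [Nat.div_lt_iff_lt_mul hm, mul_comm, ← hn]
        exact j.2
      · ext
        simp only [ZMod.val_natCast]
        exact Nat.mod_add_div _ _
    · rintro ⟨x, rfl⟩
      simp
  rw [this, Finset.card_image_of_injective, Finset.card_univ, Fintype.card_fin]
  intro x y hxy
  have h1 : i.val + m * (x : ℕ) = i.val + m * y := congrArg Fin.val hxy
  exact Fin.ext (Nat.eq_of_mul_eq_mul_left hm (Nat.add_left_cancel h1))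

theorem IsOptimalLRC.hasOptimalFieldSize {F : Type*} [Field F] [Fintype F] {n δ u d : ℕ}
    {C : Submodule F (Fin n → F)} (hδ : 1 ≤ δ) (hu : 1 ≤ u) (hn : n = (u + 1) * (δ + 1))
    (h : IsOptimalLRC C (2 * u) d 2 δ)
    (hF : ∀ N, IsPrimePow N → n ≤ N + 1 → Fintype.card F ≤ N) :
    HasOptimalFieldSize C (2 * u) d 2 δ :=
  ⟨h, fun K _ _ _ h' => hF _ (Fintype.isPrimePow_card_of_field (α := K))
    (h'.length_le_card_add_one hδ hu hn)⟩

/-! ### Explicit linear forms for the three lengths -/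

/-- Evaluation at `x` of the polynomial `v.1 + v.2 * X`. -/
def evalLinear {F : Type*} [Field F] (x : F) : F × F →ₗ[F] F :=
  LinearMap.fst F F F + x • LinearMap.snd F F F

theorem evalLinear_apply {F : Type*} [Field F] (x : F) (v : F × F) :
    evalLinear x v = v.1 + x * v.2 := rfl

theorem eq_zero_of_evalLinear_eq_zero {F : Type*} [Field F] {x y : F} (hxy : x ≠ y) {v : F × F}
    (hx : evalLinear x v = 0) (hy : evalLinear y v = 0) : v = 0 := by
  rw [evalLinear_apply] at hx hy
  have h1 : (x - y) * v.2 = 0 := by linear_combination hx - hy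
  have h2 : v.2 = 0 := (mul_eq_zero.1 h1).resolve_left (sub_ne_zero.2 hxy)
  ext
  · simpa [h2] using hx
  · exact h2

theorem isOptimalLRC_groupCode_natCast {F E : Type*} [Field F] [AddCommGroup E] [Module F E]
    [FiniteDimensional F E] {n δ u : ℕ} {ℓ : Fin n → E →ₗ[F] F} (hE : finrank F E = 2)
    (hδ : 1 ≤ δ) (hu : 1 ≤ u) (hn : n = (u + 1) * (δ + 1))
    (hℓ : ∀ j j' v, j ≠ j' → ℓ j v = 0 → ℓ j' v = 0 → v = 0) :
    IsOptimalLRC (groupCode (fun j : Fin n => ((j : ℕ) : ZMod (u + 1))) ℓ) (2 * u) (2 * δ + 1)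
      2 δ :=
  isOptimalLRC_groupCode hE hδ hu hn (ZMod.card _) (card_filter_natCast_eq hn) hℓ

theorem isCyclicCode_groupCode_natCast {F E : Type*} [Field F] [AddCommGroup E] [Module F E]
    {n m : ℕ} [NeZero m] (hmn : m ∣ n) {ℓ : ℕ → E →ₗ[F] F} (hper : Function.Periodic ℓ n)
    (A : E →ₗ[F] E) (hA : ∀ j v, ℓ (j + 1) (A v) = ℓ j v) :
    IsCyclicCode (groupCode (fun j : Fin n => ((j : ℕ) : ZMod m)) (fun j : Fin n => ℓ j)) := by
  refine isCyclicCode_groupCode (Equiv.addRight 1) A (fun j => ?_) (fun j v => ?_)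
  · have hf : Function.Periodic (fun k : ℕ => (k : ZMod m)) n := fun k => by
      simp [(ZMod.natCast_eq_zero_iff n m).2 hmn]
    simpa using hf.apply_finRotate j
  · rw [← hA j v, hper.apply_finRotate j]

theorem exists_isOptimalLRC_of_length_le_card {F : Type*} [Field F] [Fintype F] {n δ u : ℕ}
    (hδ : 1 ≤ δ) (hu : 1 ≤ u) (hn : n = (u + 1) * (δ + 1)) (hF : n ≤ Fintype.card F) :
    ∃ C : Submodule F (Fin n → F), IsOptimalLRC C (2 * u) (2 * δ + 1) 2 δ := by
  obtain ⟨x⟩ : Nonempty (Fin n ↪ F) := Function.Embedding.nonempty_of_card_le (by simpa using hF)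
  exact ⟨_, isOptimalLRC_groupCode_natCast (ℓ := fun j => evalLinear (x j)) (by simp) hδ hu hn
    fun j j' v hjj h h' => eq_zero_of_evalLinear_eq_zero (x.injective.ne hjj) h h'⟩

theorem exists_isCyclicCode_isOptimalLRC_of_length_add_one {F : Type*} [Field F] [Fintype F]
    {n δ u : ℕ} (hδ : 1 ≤ δ) (hu : 1 ≤ u) (hn : n = (u + 1) * (δ + 1))
    (hF : n + 1 = Fintype.card F) :
    ∃ C : Submodule F (Fin n → F), IsCyclicCode C ∧ IsOptimalLRC C (2 * u) (2 * δ + 1) 2 δ := by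
  obtain ⟨ω, hω⟩ := IsCyclic.exists_ofOrder_eq_natCard (α := Fˣ)
  rw [Nat.card_units, Nat.card_eq_fintype_card, ← hF, Nat.add_sub_cancel] at hω
  have hω' : orderOf (ω : F) = n := by rw [orderOf_units, hω]
  refine ⟨_, isCyclicCode_groupCode_natCast (m := u + 1) ⟨_, hn⟩
    (ℓ := fun j => evalLinear ((ω : F) ^ j))
    -- The substitution `X ↦ ω⁻¹X` compensates the move from `ω ^ j` to `ω ^ (j + 1)`.
    (fun j => ?_) (LinearMap.prodMap LinearMap.id ((ω : F)⁻¹ • LinearMap.id)) (fun j v => ?_),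
    isOptimalLRC_groupCode_natCast (by simp) hδ hu hn fun j j' v hjj h h' =>
      eq_zero_of_evalLinear_eq_zero (fun hjj' => hjj (Fin.ext ?_)) h h'⟩
  · simp only [pow_add, ← hω', pow_orderOf_eq_one, mul_one]
  · simp only [evalLinear_apply, LinearMap.prodMap_apply, LinearMap.id_apply,
      LinearMap.smul_apply, smul_eq_mul, pow_succ]
    rw [mul_assoc, mul_inv_cancel_left₀ ω.ne_zero]
  · exact pow_injOn_Iio_orderOf (hω'.symm ▸ j.2) (hω'.symm ▸ j'.2) hjj'

/-- The forms are `v ↦ f (v β ^ j)` on the quadratic extension, with `β` of order `|F| + 1`. Since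
`ker f` is a line, two of them are dependent only if the powers of `β` differ by a factor in `F`;
for odd `n` the powers with distinct exponents below `n` do not. -/
theorem exists_isCyclicCode_isOptimalLRC_of_length_eq_add_one {F : Type*} [Field F] [Fintype F]
    {n δ u : ℕ} (hδ : 1 ≤ δ) (hu : 1 ≤ u) (hn : n = (u + 1) * (δ + 1)) (hodd : Odd n)
    (hF : n = Fintype.card F + 1) :
    ∃ C : Submodule F (Fin n → F), IsCyclicCode C ∧ IsOptimalLRC C (2 * u) (2 * δ + 1) 2 δ := by
  obtain ⟨p, hp⟩ := CharP.exists F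
  have : Fact p.Prime := ⟨CharP.char_is_prime F p⟩
  let E := FiniteField.Extension F p 2
  have hE : finrank F E = 2 := FiniteField.finrank_extension F p 2
  obtain ⟨γ, hγ⟩ := IsCyclic.exists_ofOrder_eq_natCard (α := Eˣ)
  obtain ⟨Q, hQ⟩ : ∃ Q, Fintype.card F = Q + 1 :=
    ⟨Fintype.card F - 1, by have := Fintype.card_pos (α := F); omega⟩
  have hQ0 : Q ≠ 0 := by have := Fintype.one_lt_card (α := F); omega
  have hnQ : n = Q + 2 := by omega
  rw [Nat.card_units, FiniteField.natCard_extension, Nat.card_eq_fintype_card, hQ,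
    show (Q + 1) ^ 2 - 1 = Q * n by
      rw [hnQ, Nat.sub_eq_iff_eq_add (Nat.one_le_pow _ _ (by omega))]; ring] at hγ
  have hβ : orderOf (γ ^ Q) = n := by
    rw [orderOf_pow_of_dvd hQ0 (hγ ▸ dvd_mul_right _ _), hγ,
      Nat.mul_div_cancel_left _ (Nat.pos_of_ne_zero hQ0)]
  obtain ⟨β, hβ⟩ : ∃ β : Eˣ, orderOf (β : E) = n := ⟨γ ^ Q, by rw [orderOf_units, hβ]⟩
  -- Here `Q = |F| - 1` and `n = Q + 2`, so the gcd divides 2. This is where `n` odd enters: raising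
  -- to the power `Q` kills factors from `F` without merging powers of `β`.
  have hcop : Nat.Coprime n Q := by
    rw [hnQ, Nat.coprime_self_add_left]
    rw [hnQ] at hodd
    have : Odd Q := by
      rcases hodd with ⟨k, hk⟩
      exact ⟨k - 1, by omega⟩
    exact Nat.coprime_two_left.2 this
  obtain ⟨f, hf⟩ := exists_ne (0 : Module.Dual F E)
  have hker : finrank F (LinearMap.ker f) = 1 := by
    have h1 := LinearMap.finrank_range_add_finrank_ker f
    rw [LinearMap.range_eq_top.2 (LinearMap.surjective hf), finrank_top, finrank_self, hE] at h1
    omega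
  refine ⟨_, isCyclicCode_groupCode_natCast (m := u + 1) ⟨_, hn⟩
    (ℓ := fun j => f ∘ₗ LinearMap.mulRight F ((β : E) ^ j))
    (fun j => ?_) (LinearMap.mulRight F (β⁻¹ : E)) (fun j v => ?_),
    isOptimalLRC_groupCode_natCast hE hδ hu hn fun j j' v hjj h h' => ?_⟩
  · simp only [pow_add, ← hβ, pow_orderOf_eq_one, mul_one]
  · simp only [LinearMap.comp_apply, LinearMap.mulRight_apply, pow_succ']
    rw [mul_assoc, inv_mul_cancel_left₀ β.ne_zero]
  · by_contra hv
    simp only [LinearMap.comp_apply, LinearMap.mulRight_apply] at h h'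
    obtain ⟨c, hc⟩ := (finrank_eq_one_iff_of_nonzero'
      (⟨v * (β : E) ^ (j : ℕ), h⟩ : LinearMap.ker f) (by
        simpa [Subtype.ext_iff] using hv)).1 hker ⟨v * (β : E) ^ (j' : ℕ), h'⟩
    have hc1 : c • (v * (β : E) ^ (j : ℕ)) = v * (β : E) ^ (j' : ℕ) := congrArg Subtype.val hc
    have hc2 : algebraMap F E c * (β : E) ^ (j : ℕ) = (β : E) ^ (j' : ℕ) := by
      apply mul_left_cancel₀ hv
      rw [← hc1, Algebra.smul_def]; ring
    have hc0 : c ≠ 0 := by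
      rintro rfl
      rw [map_zero, zero_mul] at hc2
      exact pow_ne_zero _ β.ne_zero hc2.symm
    have hcQ : c ^ Q = 1 := by
      have := FiniteField.pow_card_sub_one_eq_one c hc0
      rwa [hQ, Nat.add_sub_cancel] at this
    have h1 : (β : E) ^ ((j : ℕ) * Q) = (β : E) ^ ((j' : ℕ) * Q) := by
      rw [pow_mul, pow_mul, ← hc2, mul_pow, ← map_pow, hcQ, map_one, one_mul]
    have h2 : (β ^ ((j : ℕ) * Q) : Eˣ) = β ^ ((j' : ℕ) * Q) := Units.ext (by simpa using h1)
    rw [pow_eq_pow_iff_modEq, ← orderOf_units, hβ] at h2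
    have h3 := Nat.ModEq.cancel_right_of_coprime hcop h2
    exact hjj (Fin.ext (Nat.ModEq.eq_of_lt_of_lt h3 j.2 j'.2))

/-! ### The three families -/

theorem mainTheorem12 :
    -- cyclic codes with `r = δ = 2`, `n = 3m = q^b + 1`, `k = 2u`, `u` even, `m = u + 1`
    (∀ (q b n m u : ℕ), IsPrimePow q → 1 ≤ b → n = q ^ b + 1 → n = 3 * m → Even u → 0 < u →
      m = u + 1 →
      ∀ (F : Type*) [Field F] [Fintype F], Fintype.card F = q ^ b →
        (∃ (C : Submodule F (Fin n → F)) (d : ℕ),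
          IsCyclicCode C ∧ IsOptimalLRC C (2 * u) d 2 2) ∧
        ∀ (C : Submodule F (Fin n → F)) (d : ℕ),
          IsCyclicCode C → IsOptimalLRC C (2 * u) d 2 2 →
            HasOptimalFieldSize C (2 * u) d 2 2) ∧
    -- Tamo-Barg codes with `r = 2`, `q = r + δ - 1`, `n = q^b`, `u = q^(b-1) - 1`
    (∀ (q b δ n u : ℕ), IsPrimePow q → 2 ≤ b → q + 1 = 2 + δ → n = q ^ b →
      u + 1 = q ^ (b - 1) → ¬ IsPrimePow (q ^ b - 1) →
      ∀ (F : Type*) [Field F] [Fintype F], Fintype.card F = q ^ b →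
        (∃ C : Submodule F (Fin n → F),
          IsOptimalLRC C (2 * u) ((q ^ (b - 1) - u) * q + δ) 2 δ) ∧
        ∀ C : Submodule F (Fin n → F),
          IsOptimalLRC C (2 * u) ((q ^ (b - 1) - u) * q + δ) 2 δ →
            HasOptimalFieldSize C (2 * u) ((q ^ (b - 1) - u) * q + δ) 2 δ) ∧
    -- Tamo-Barg cyclic codes with `r = 2`, `n = m (r + δ - 1) = q^b - 1`, `k = 2u`, `m = u + 1`
    (∀ (q b δ n m u : ℕ), IsPrimePow q → 1 ≤ b → 1 ≤ δ → n + 1 = q ^ b → n = m * (δ + 1) →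
      0 < u → m = u + 1 → ¬ IsPrimePow (q ^ b - 1) → ¬ IsPrimePow (q ^ b - 2) →
      ∀ (F : Type*) [Field F] [Fintype F], Fintype.card F = q ^ b →
        (∃ (C : Submodule F (Fin n → F)) (d : ℕ),
          IsCyclicCode C ∧ IsOptimalLRC C (2 * u) d 2 δ) ∧
        ∀ (C : Submodule F (Fin n → F)) (d : ℕ),
          IsCyclicCode C → IsOptimalLRC C (2 * u) d 2 δ →
            HasOptimalFieldSize C (2 * u) d 2 δ) := by
  refine ⟨?_, ?_, ?_⟩
  · intro q b n m u _ _ hq hn hu hu0 hm F _ _ hF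
    have hn' : n = (u + 1) * (2 + 1) := by rw [hn, hm, mul_comm]
    -- The evenness of `u` serves only to make `n` odd for the quadratic extension.
    have hodd : Odd n := by rw [hn']; exact hu.add_one.mul (by decide)
    refine ⟨?_, fun C d _ hC => hC.hasOptimalFieldSize (by omega) hu0 hn' fun N _ hN => ?_⟩
    · obtain ⟨C, hC⟩ := exists_isCyclicCode_isOptimalLRC_of_length_eq_add_one (F := F) (δ := 2)
        (by omega) hu0 hn' hodd (by rw [hF, hq])
      exact ⟨C, _, hC⟩
    · omega
  · intro q b δ n u hq hb hδ hn hu hpp F _ _ hF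
    have hq2 := hq.two_le
    have hpow : q ^ b = q ^ (b - 1) * q := by rw [← pow_succ]; congr 1; omega
    have hu0 : 1 ≤ u := by
      have := Nat.le_self_pow (by omega : b - 1 ≠ 0) q
      omega
    have hn' : n = (u + 1) * (δ + 1) := by rw [hn, hpow, hu]; congr 1; omega
    -- The first factor is 1, and `q = δ + 1`.
    have hd : (q ^ (b - 1) - u) * q + δ = 2 * δ + 1 := by
      rw [← hu, Nat.add_sub_cancel_left]; omega
    refine ⟨?_, fun C hC => hC.hasOptimalFieldSize (by omega) hu0 hn' fun N hN hnN => ?_⟩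
    · rw [hd]
      exact exists_isOptimalLRC_of_length_le_card (by omega) hu0 hn' (by rw [hF, hn])
    · by_contra hlt
      exact hpp ((by omega : N = q ^ b - 1) ▸ hN)
  · intro q b δ n m u _ _ hδ hq hn hu0 hm hpp hpp' F _ _ hF
    have hn' : n = (u + 1) * (δ + 1) := by rw [hn, hm]
    refine ⟨?_, fun C d _ hC => hC.hasOptimalFieldSize hδ hu0 hn' fun N hN hnN => ?_⟩
    · obtain ⟨C, hC⟩ := exists_isCyclicCode_isOptimalLRC_of_length_add_one (F := F) hδ hu0 hn'
        (by rw [hF, hq])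
      exact ⟨C, _, hC⟩
    · have h1 : N ≠ q ^ b - 1 := fun h => hpp (h ▸ hN)
      have h2 : N ≠ q ^ b - 2 := fun h => hpp' (h ▸ hN)
      omega
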